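/- Let $\beta,b,c>0$ and let $n(dz)=k(z)\,dz$ be a measure on $(0,\infty)$ with a measurable density $k\ge 0$ such that $\int_0^\infty (1\wedge z)k(z)\,dz<\infty$. Put $$\phi(z)=bz+cz^2,\qquad \psi(z)=\beta z+\int_0^\infty(1-e^{-zu})\,n(du)\qquad(z\ge 0),$$ and, for $t,\lambda\ge 0$, let $$v_t(\lambda)=\frac{e^{-bt}\lambda}{1+\frac{c\lambda}{b}(1-e^{-bt})},$$ which is the solution of $\frac{\partial}{\partial t}v_t(\lambda)=-\phi(v_t(\lambda))$, $v_0(\lambda)=\lambda$. Let $X=(X_t)_{t\ge 0}$ be a strictly stationary continuous-state branching process with immigration (CBI-process) with branching mechanism $\phi$ and immigration mechanism $\psi$, that is, a strictly stationary Markov process with state space $\mathbb{R}_+=[0,\infty)$ whose transition semigroup $(P_t)_{t\ge 0}$ satisfies $$\int_0^\infty e^{-\lambda y}P_t(x,dy)=\exp\Big\{-x\,v_t(\lambda)-\int_0^t\psi(v_s(\lambda))\,ds\Big\}\qquad(t,x,\lambda\ge 0).$$ Let $\eta$ be the law of $X_0$, and for $\lambda\ge 0$ let $L_\eta(\lambda)=\int_0^\infty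 e^{-\lambda x}\,\eta(dx)$ and $L_{1,m}(\lambda)=\frac1m\sum_{k=1}^m e^{-\lambda X_k}$ for $m\ge 1$. Then $$\int_0^\infty\psi(v_s(\lambda))\,ds<\infty\quad\text{and}\quad L_\eta(\lambda)=\exp\Big\{-\int_0^\infty\psi(v_s(\lambda))\,ds\Big\}\qquad(\lambda\ge 0),$$ and, almost surely, for every compact set $A\subset\mathbb{R}_+$, $$\sup_{\lambda\in A}\big|L_{1,m}(\lambda)-L_\eta(\lambda)\big|\longrightarrow 0\qquad(m\to\infty).$$ -/

import Mathlib

open MeasureTheory ProbabilityTheory Filter Set Topology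
open scoped NNReal ENNReal

noncomputable section

namespace CBI

/-- The branching mechanism `φ(z) = b z + c z²`. -/
def branching (b c z : ℝ) : ℝ := b * z + c * z ^ 2

/-- The immigration mechanism `ψ(z) = β z + ∫_{(0,∞)} (1 - e^{-zu}) n(du)`. -/
def immigration (β : ℝ) (n : Measure ℝ) (z : ℝ) : ℝ :=
  β * z + ∫ u in Ioi (0 : ℝ), (1 - Real.exp (-(z * u))) ∂n

/-- The cumulant semigroup `v_t(l)` of the branching mechanism: the solution of
`∂v_t/∂t = -φ(v_t)`, `v_0 = l` (see `cumulant_zero` and `hasDerivAt_cumulant`). -/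
def cumulant (b c t l : ℝ) : ℝ :=
  Real.exp (-(b * t)) * l / (1 + c * l / b * (1 - Real.exp (-(b * t))))

theorem cumulant_zero (b c l : ℝ) : cumulant b c 0 l = l := by
  simp [cumulant]

theorem hasDerivAt_cumulant {b c t l : ℝ} (hb : 0 < b) (hc : 0 < c) (ht : 0 ≤ t) (hl : 0 ≤ l) :
    HasDerivAt (fun s => cumulant b c s l) (-branching b c (cumulant b c t l)) t := by
  have he : Real.exp (-(b * t)) ≤ 1 := Real.exp_le_one_iff.2 (by nlinarith [mul_nonneg hb.le ht])
  have hD : 0 < 1 + c * l / b * (1 - Real.exp (-(b * t))) := by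
    have : 0 ≤ c * l / b * (1 - Real.exp (-(b * t))) :=
      mul_nonneg (by positivity) (by linarith)
    linarith
  have h1 : HasDerivAt (fun s : ℝ => Real.exp (-(b * s))) (Real.exp (-(b * t)) * (-b)) t := by
    have h0 : HasDerivAt (fun s : ℝ => -(b * s)) (-b) t := by
      have h := (hasDerivAt_id' t).const_mul (-b)
      simp only [mul_one, neg_mul] at h
      exact h
    exact h0.exp
  have h2 := (h1.mul_const l).div (((h1.const_sub 1).const_mul (c * l / b)).const_add 1) hD.ne'
  refine h2.congr_deriv ?_
  unfold branching cumulant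
  have hb' := hb.ne'
  have hD' := hD.ne'
  generalize Real.exp (-(b * t)) = e at hD' ⊢
  generalize hd : 1 + c * l / b * (1 - e) = d at hD' ⊢
  field_simp
  ring

/-- `P` is the transition semigroup on `ℝ₊ = [0,∞)` of the CBI-process with branching mechanism
`φ(z) = b z + c z²` and immigration mechanism `ψ(z) = β z + ∫ (1 - e^{-zu}) n(du)`:
`∫ e^{-l y} P_t(x,dy) = exp(-x v_t(l) - ∫₀ᵗ ψ(v_s(l)) ds)`. -/
structure IsTransitionSemigroup (β b c : ℝ) (n : Measure ℝ) (P : ℝ≥0 → Kernel ℝ≥0 ℝ≥0) :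
    Prop where
  markov : ∀ t, IsMarkovKernel (P t)
  semigroup : ∀ s t, P (s + t) = P t ∘ₖ P s
  laplace : ∀ (t x : ℝ≥0) (l : ℝ), 0 ≤ l →
    ∫ y : ℝ≥0, Real.exp (-(l * y)) ∂(P t x) =
      Real.exp (-(x * cumulant b c t l)
        - ∫ s in (0 : ℝ)..t, immigration β n (cumulant b c s l))

variable {Ω : Type*} [MeasurableSpace Ω]

/-- The history `σ(X_r : r ≤ s)` of the process up to time `s`. -/
abbrev history (X : ℝ≥0 → Ω → ℝ≥0) (s : ℝ≥0) : MeasurableSpace Ω :=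
  ⨆ r : Iic s, MeasurableSpace.comap (X r) inferInstance

/-- `X` is, under `μ`, a CBI-process: a Markov process with state space `ℝ₊` whose transition
semigroup is the CBI semigroup. -/
def IsCBIProcess (β b c : ℝ) (n : Measure ℝ) (X : ℝ≥0 → Ω → ℝ≥0) (μ : Measure Ω) : Prop :=
  (∀ t, Measurable (X t)) ∧
  ∃ P : ℝ≥0 → Kernel ℝ≥0 ℝ≥0, IsTransitionSemigroup β b c n P ∧
    ∀ (s t : ℝ≥0) (A : Set ℝ≥0), MeasurableSet A →
      μ⟦X (s + t) ⁻¹' A | history X s⟧ =ᵐ[μ] fun ω => (P t (X s ω)).real A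

/-- Strict stationarity: `(X_{t+h})_{t ≥ 0}` and `(X_t)_{t ≥ 0}` have the same law
for every `h ≥ 0`. -/
def IsStationary (X : ℝ≥0 → Ω → ℝ≥0) (μ : Measure Ω) : Prop :=
  ∀ h : ℝ≥0, μ.map (fun ω t => X (t + h) ω) = μ.map (fun ω t => X t ω)

/-- The Laplace transform `L_η(l) = ∫ e^{-l x} η(dx)` of a measure on `ℝ₊`. -/
def laplaceTransform (η : Measure ℝ≥0) (l : ℝ) : ℝ := ∫ x : ℝ≥0, Real.exp (-(l * x)) ∂η

/-- The empirical Laplace transform `L_{1,m}(l) = (1/m) ∑_{k=1}^m e^{-l X_k}`. -/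
def empiricalLaplace (X : ℝ≥0 → Ω → ℝ≥0) (m : ℕ) (l : ℝ) (ω : Ω) : ℝ :=
  (1 / (m : ℝ)) * ∑ k ∈ Finset.Icc 1 m, Real.exp (-(l * X (k : ℝ≥0) ω))

end CBI

end

/-! Stationarity and the Laplace formula give `L(l) = L(v_t(l)) exp(-∫₀ᵗ ψ(v_s(l)) ds)` with `L` the
stationary transform. Since `v_t(l) → 0` and `L(0) = 1`, letting `t → ∞` identifies `L`; as `L(l) >
0` and `ψ ≥ 0`, the bounded partial integrals also force integrability
(`integrableOn_and_laplaceTransform_eq`).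

The same formula, with `X_s` kept in the integrand, shows that the correlation of `e^{-l X_s}` with
`e^{-l X_{s+k}}` tends to `L(l)²` (`tendsto_integral_exp_mul_exp`). Decaying correlations suffice
for an almost sure law of large numbers (`ae_tendsto_birkhoffSum_div`): averaging over widely spaced
times makes the observable small in `L¹`, a maximal inequality turns this into pointwise control,
and the averaging does not affect the limit of Birkhoff averages. Monotonicity in `l` upgrades
convergence at rational points to uniform convergence on compacts. -/

noncomputable section

/-! ### Pointwise ergodic theorem from decay of correlations. -/

namespace ErgodicAverage

variable {α : Type*}

/-- The running maximum `max_{0 ≤ k ≤ n} ∑_{i < k} f (T^i x)`. -/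
def maxSum (T : α → α) (f : α → ℝ) : ℕ → α → ℝ
  | 0, _ => 0
  | n + 1, x => max 0 (f x + maxSum T f n (T x))

theorem maxSum_nonneg (T : α → α) (f : α → ℝ) (n : ℕ) (x : α) : 0 ≤ maxSum T f n x := by
  cases n with
  | zero => exact le_rfl
  | succ n => exact le_max_left _ _

theorem maxSum_le_succ (T : α → α) (f : α → ℝ) (n : ℕ) (x : α) :
    maxSum T f n x ≤ maxSum T f (n + 1) x := by
  induction n generalizing x with
  | zero => exact le_max_left _ _
  | succ n ih => exact max_le_max le_rfl (by have := ih (T x); linarith)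

theorem monotone_maxSum (T : α → α) (f : α → ℝ) (x : α) :
    Monotone fun n => maxSum T f n x :=
  monotone_nat_of_le_succ fun n => maxSum_le_succ T f n x

theorem birkhoffSum_le_maxSum (T : α → α) (f : α → ℝ) (n : ℕ) (x : α) :
    birkhoffSum T f n x ≤ maxSum T f n x := by
  induction n generalizing x with
  | zero => simp [maxSum]
  | succ n ih =>
    rw [birkhoffSum_succ']
    exact (add_le_add_right (ih (T x)) _).trans (le_max_right _ _)

/-- Averages of `f` along the iterates `T^{ip}`, `i < N`. -/
def sparseAverage (T : α → α) (f : α → ℝ) (N p : ℕ) (x : α) : ℝ :=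
  (N : ℝ)⁻¹ * ∑ i ∈ Finset.range N, f (T^[i * p] x)

theorem abs_sparseAverage_le {T : α → α} {f : α → ℝ} {C : ℝ} (hC : ∀ x, |f x| ≤ C) {N : ℕ} (hN : 0 < N) (p : ℕ) (x : α) :
    |sparseAverage T f N p x| ≤ C := by
  have hN' : (0 : ℝ) < N := by exact_mod_cast hN
  rw [sparseAverage, abs_mul, abs_of_pos (inv_pos.2 hN'), inv_mul_le_iff₀ hN']
  calc _ ≤ ∑ i ∈ Finset.range N, |f (T^[i * p] x)| := Finset.abs_sum_le_sum_abs _ _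
    _ ≤ ∑ i ∈ Finset.range N, C := Finset.sum_le_sum fun i _ => hC _
    _ = N * C := by simp

/-- Each unit shift of the starting point changes only two boundary terms, each at most `C` in size.
-/
theorem abs_birkhoffSum_comp_iterate_sub_le {T : α → α} {f : α → ℝ} {C : ℝ} (hC : ∀ x, |f x| ≤ C) (n q : ℕ) (x : α) :
    |birkhoffSum T f n (T^[q] x) - birkhoffSum T f n x| ≤ 2 * C * q := by
  induction q with
  | zero => simp
  | succ q ih =>
    rw [Function.iterate_succ_apply']
    have h1 := birkhoffSum_apply_sub_birkhoffSum T f n (T^[q] x)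
    have h2 := abs_le.1 (hC (T^[n] (T^[q] x)))
    have h3 := abs_le.1 (hC (T^[q] x))
    have h4 := abs_le.1 ih
    push_cast
    rw [abs_le]
    constructor <;> nlinarith

/-- Swapping the sums exhibits the left term as a mean of Birkhoff sums of `f` started at `T^{ip}
x`. The bound is independent of `n`, so `f` and its sparse average have the same asymptotic means.
-/
theorem abs_birkhoffSum_sparseAverage_sub_le {T : α → α} {f : α → ℝ} {C : ℝ} (hC : ∀ x, |f x| ≤ C) {N : ℕ} (hN : 0 < N)
    (p n : ℕ) (x : α) :
    |birkhoffSum T (sparseAverage T f N p) n x - birkhoffSum T f n x| ≤ 2 * C * (N * p) := by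
  have hN' : (0 : ℝ) < N := by exact_mod_cast hN
  have hC0 : 0 ≤ C := (abs_nonneg _).trans (hC x)
  have h : birkhoffSum T (sparseAverage T f N p) n x - birkhoffSum T f n x =
      (N : ℝ)⁻¹ * ∑ i ∈ Finset.range N,
        (birkhoffSum T f n (T^[i * p] x) - birkhoffSum T f n x) := by
    rw [Finset.sum_sub_distrib, mul_sub]
    congr 1
    · simp only [birkhoffSum, sparseAverage]
      rw [← Finset.mul_sum, Finset.sum_comm]
      simp only [← Function.iterate_add_apply, add_comm]
    · simp [hN'.ne']
  rw [h, abs_mul, abs_of_pos (inv_pos.2 hN'), inv_mul_le_iff₀ hN']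
  calc _ ≤ ∑ i ∈ Finset.range N, |birkhoffSum T f n (T^[i * p] x) - birkhoffSum T f n x| :=
        Finset.abs_sum_le_sum_abs _ _
    _ ≤ ∑ i ∈ Finset.range N, 2 * C * (N * p) := by
        refine Finset.sum_le_sum fun i hi =>
          (abs_birkhoffSum_comp_iterate_sub_le hC n (i * p) x).trans ?_
        have : (i : ℝ) ≤ N := by exact_mod_cast (Finset.mem_range.1 hi).le
        push_cast
        gcongr
    _ = N * (2 * C * (N * p)) := by simp

variable [MeasurableSpace α] {ν : Measure α} {T : α → α} {f : α → ℝ}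

theorem measurable_maxSum (hT : Measurable T) (hf : Measurable f) (n : ℕ) :
    Measurable (maxSum T f n) := by
  induction n with
  | zero => exact measurable_const
  | succ n ih => exact measurable_const.max (hf.add (ih.comp hT))

theorem integrable_maxSum (hT : MeasurePreserving T ν ν) (hf : Integrable f ν) (n : ℕ) :
    Integrable (maxSum T f n) ν := by
  induction n with
  | zero => exact integrable_zero _ _ _
  | succ n ih =>
    exact (integrable_zero _ _ _).sup (hf.add (hT.integrable_comp_of_integrable ih))

/-- The maximal ergodic theorem. -/
theorem setIntegral_maxSum_pos_nonneg (hT : MeasurePreserving T ν ν) (hfm : Measurable f)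
    (hf : Integrable f ν) (n : ℕ) : 0 ≤ ∫ x in {x | 0 < maxSum T f n x}, f x ∂ν := by
  have hE : MeasurableSet {x | 0 < maxSum T f n x} :=
    measurableSet_lt measurable_const (measurable_maxSum hT.measurable hfm n)
  have hQ := integrable_maxSum hT hf n
  have hQT := hT.integrable_comp_of_integrable hQ
  -- Where the maximum is positive, the recursion bounds it by `f` plus the maximum at `T x`. After
  -- integration the two maxima cancel by invariance of `ν`.
  have hle : ∀ x, maxSum T f n x ≤
      {x | 0 < maxSum T f n x}.indicator f x + (maxSum T f n ∘ T) x := by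
    intro x
    by_cases hx : 0 < maxSum T f n x
    · rw [indicator_of_mem (by exact hx)]
      cases n with
      | zero => simp [maxSum] at hx
      | succ n =>
        have h1 := maxSum_le_succ T f n (T x)
        simp only [maxSum, lt_max_iff, lt_irrefl, false_or, Function.comp] at hx h1 ⊢
        rw [max_eq_right hx.le]
        linarith
    · rw [indicator_of_notMem (by exact hx)]
      have := maxSum_nonneg T f n (T x)
      simp only [Function.comp]
      linarith
  have h := integral_mono hQ ((hf.indicator hE).add hQT) hle
  have h2 : ∫ x, (maxSum T f n ∘ T) x ∂ν = ∫ x, maxSum T f n x ∂ν :=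
    (integral_map hT.aemeasurable (by rw [hT.map_eq]; exact hQ.aestronglyMeasurable)).symm.trans
      (by rw [hT.map_eq])
  rw [integral_add' (hf.indicator hE) hQT, h2, integral_indicator hE] at h
  linarith

/-- The weak-type maximal inequality for ergodic averages. -/
theorem measureReal_exists_lt_birkhoffSum_le [IsProbabilityMeasure ν]
    (hT : MeasurePreserving T ν ν) (hfm : Measurable f) (hf : Integrable f ν) (hf0 : ∀ x, 0 ≤ f x)
    {ε : ℝ} (hε : 0 < ε) :
    ν.real {x | ∃ n : ℕ, n * ε < birkhoffSum T f n x} ≤ (∫ x, f x ∂ν) / ε := by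
  -- The event says that some Birkhoff sum of `f - ε` is positive, so the maximal ergodic theorem
  -- applies to `g`.
  set g : α → ℝ := fun x => f x - ε with hg
  have hgm : Measurable g := hfm.sub_const ε
  have hgi : Integrable g ν := hf.sub (integrable_const ε)
  set E : ℕ → Set α := fun n => {x | 0 < maxSum T g n x} with hE
  have hEm : ∀ n, MeasurableSet (E n) := fun n =>
    measurableSet_lt measurable_const (measurable_maxSum hT.measurable hgm n)
  have hmono : Monotone E := fun m n hmn x hx => lt_of_lt_of_le hx (monotone_maxSum T g x hmn)
  have hsub : {x | ∃ n : ℕ, n * ε < birkhoffSum T f n x} ⊆ ⋃ n, E n := by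
    rintro x ⟨n, hn⟩
    refine mem_iUnion.2 ⟨n, lt_of_lt_of_le ?_ (birkhoffSum_le_maxSum T g n x)⟩
    simp only [birkhoffSum, hg, Finset.sum_sub_distrib, Finset.sum_const, Finset.card_range,
      nsmul_eq_mul] at hn ⊢
    linarith
  have hbd : ∀ n, ν.real (E n) ≤ (∫ x, f x ∂ν) / ε := by
    intro n
    have h := setIntegral_maxSum_pos_nonneg hT hgm hgi n
    rw [hg, integral_sub hf.integrableOn (integrable_const ε), setIntegral_const, smul_eq_mul] at h
    have h1 := setIntegral_le_integral (s := E n) hf (Eventually.of_forall hf0)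
    rw [le_div_iff₀ hε]
    linarith
  have hlim : Tendsto (fun n => ν.real (E n)) atTop (𝓝 (ν.real (⋃ n, E n))) :=
    (ENNReal.tendsto_toReal (measure_ne_top _ _)).comp (tendsto_measure_iUnion_atTop hmono)
  exact (measureReal_mono hsub).trans (le_of_tendsto' hlim hbd)

theorem integral_comp_iterate_mul_comp_iterate (hT : MeasurePreserving T ν ν) (hfm : Measurable f)
    (i k : ℕ) : ∫ x, f (T^[i] x) * f (T^[i + k] x) ∂ν = ∫ x, f x * f (T^[k] x) ∂ν := by
  have h := hT.iterate i
  have hm : Measurable fun x => f x * f (T^[k] x) :=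
    hfm.mul (hfm.comp (hT.measurable.iterate k))
  conv_rhs => rw [← h.map_eq]
  rw [integral_map h.aemeasurable hm.aestronglyMeasurable]
  simp only [← Function.iterate_add_apply, add_comm k i]

theorem measurable_sparseAverage (hT : Measurable T) (hf : Measurable f) (N p : ℕ) :
    Measurable (sparseAverage T f N p) :=
  (Finset.measurable_sum _ fun i _ => hf.comp (hT.iterate (i * p))).const_mul _

theorem integrable_of_abs_le [IsFiniteMeasure ν] (hf : Measurable f) {C : ℝ}
    (hC : ∀ x, |f x| ≤ C) : Integrable f ν :=
  Integrable.of_bound hf.aestronglyMeasurable C (Eventually.of_forall hC)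

/-- Expanding the square, the diagonal contributes at most `C²/N`; off the diagonal the time gaps
are at least `p`, so each correlation is at most `δ`. -/
theorem integral_sparseAverage_sq_le [IsProbabilityMeasure ν] (hT : MeasurePreserving T ν ν)
    (hfm : Measurable f) {C δ : ℝ} (hC : ∀ x, |f x| ≤ C) {p : ℕ}
    (hδ : 0 ≤ δ) (hp : ∀ k, p ≤ k → |∫ x, f x * f (T^[k] x) ∂ν| ≤ δ) {N : ℕ} (hN : 0 < N) :
    ∫ x, sparseAverage T f N p x ^ 2 ∂ν ≤ C ^ 2 / N + δ := by
  have hN' : (0 : ℝ) < N := by exact_mod_cast hN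
  have hint : ∀ i j : ℕ, Integrable (fun x => f (T^[i] x) * f (T^[j] x)) ν := fun i j =>
    integrable_of_abs_le ((hfm.comp (hT.measurable.iterate i)).mul
      (hfm.comp (hT.measurable.iterate j))) (C := C * C) fun x => by
        rw [abs_mul]
        exact mul_le_mul (hC _) (hC _) (abs_nonneg _) ((abs_nonneg _).trans (hC x))
  have hexp : ∀ x, sparseAverage T f N p x ^ 2 = ((N : ℝ)⁻¹) ^ 2 *
      ∑ i ∈ Finset.range N, ∑ j ∈ Finset.range N, f (T^[i * p] x) * f (T^[j * p] x) := by
    intro x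
    rw [sparseAverage, mul_pow, pow_two (∑ i ∈ _, _), Finset.sum_mul_sum]
  have hoff : ∀ i k : ℕ, ∫ x, f (T^[i * p] x) * f (T^[(i + (k + 1)) * p] x) ∂ν ≤ δ := by
    intro i k
    rw [add_mul i, integral_comp_iterate_mul_comp_iterate hT hfm]
    exact (le_abs_self _).trans (hp _ (Nat.le_mul_of_pos_left _ (Nat.succ_pos k)))
  have hterm : ∀ i j : ℕ, ∫ x, f (T^[i * p] x) * f (T^[j * p] x) ∂ν ≤
      (if i = j then C ^ 2 else 0) + δ := by
    intro i j
    rcases lt_trichotomy i j with h | rfl | h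
    · obtain ⟨k, rfl⟩ := Nat.exists_eq_add_of_lt h
      rw [if_neg h.ne, zero_add]
      exact hoff i k
    · rw [if_pos rfl]
      have : ∫ x, f (T^[i * p] x) * f (T^[i * p] x) ∂ν ≤ ∫ _, C ^ 2 ∂ν := by
        refine integral_mono (hint _ _) (integrable_const _) fun x => ?_
        have := abs_le.1 (hC (T^[i * p] x))
        simp only
        nlinarith
      simp only [integral_const, probReal_univ, one_smul] at this
      linarith
    · obtain ⟨k, rfl⟩ := Nat.exists_eq_add_of_lt h
      rw [if_neg h.ne', zero_add]
      simp only [mul_comm (f (T^[(j + k + 1) * p] _))]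
      exact hoff j k
  simp only [hexp]
  rw [integral_const_mul, integral_finsetSum _ fun i _ => integrable_finsetSum _ fun j _ => hint _ _]
  simp only [integral_finsetSum _ fun j _ => hint _ _]
  calc _ ≤ ((N : ℝ)⁻¹) ^ 2 * ∑ i ∈ Finset.range N, ∑ j ∈ Finset.range N,
        ((if i = j then C ^ 2 else 0) + δ) := by
        gcongr with i _ j _
        exact hterm i j
    _ = C ^ 2 / N + δ := by
        have : ∀ i ∈ Finset.range N, ∑ j ∈ Finset.range N, ((if i = j then C ^ 2 else 0) + δ) =
            C ^ 2 + N * δ := by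
          intro i hi
          rw [Finset.sum_add_distrib, Finset.sum_ite_eq, if_pos hi]
          simp
        rw [Finset.sum_congr rfl this]
        simp
        field_simp

theorem integral_abs_le_of_integral_sq_le [IsProbabilityMeasure ν] (hf : Integrable f ν)
    (hf2 : Integrable (fun x => f x ^ 2) ν) {a : ℝ} (ha : 0 < a) (h : ∫ x, f x ^ 2 ∂ν ≤ a ^ 2) :
    ∫ x, |f x| ∂ν ≤ a := by
  -- Integrating `2a|f| ≤ a² + f²` takes the place of Cauchy–Schwarz.
  have h1 : ∫ x, 2 * a * |f x| ∂ν ≤ ∫ x, (a ^ 2 + f x ^ 2) ∂ν := by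
    refine integral_mono (hf.abs.const_mul _) ((integrable_const _).add hf2) fun x => ?_
    have := sq_nonneg (a - |f x|)
    have h2 := sq_abs (f x)
    simp only
    nlinarith
  rw [integral_const_mul, integral_add (integrable_const _) hf2] at h1
  simp only [integral_const, probReal_univ, one_smul] at h1
  nlinarith

theorem measureReal_not_eventually_birkhoffSum_le [IsProbabilityMeasure ν]
    (hT : MeasurePreserving T ν ν) (hfm : Measurable f) {C : ℝ} (hC : ∀ x, |f x| ≤ C)
    (hmix : Tendsto (fun k => ∫ x, f x * f (T^[k] x) ∂ν) atTop (𝓝 0))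
    {ε δ : ℝ} (hε : 0 < ε) (hδ : 0 < δ) :
    ν.real {x | ¬ ∀ᶠ n : ℕ in atTop, |birkhoffSum T f n x| ≤ n * (2 * ε)} ≤ δ := by
  -- With `∫ |h| ≤ a`, the weak-type inequality at level `ε` yields exactly `δ`.
  set a := ε * δ with ha
  have ha0 : 0 < a := mul_pos hε hδ
  obtain ⟨p, hp⟩ := eventually_atTop.1
    ((tendsto_order.1 hmix.abs).2 (a ^ 2 / 2) (by rw [abs_zero]; positivity))
  obtain ⟨N, hN⟩ := exists_nat_gt (2 * C ^ 2 / a ^ 2)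
  have hN' : (0 : ℝ) < N := lt_of_le_of_lt (by positivity) hN
  have hN0 : 0 < N := by exact_mod_cast hN'
  set h := sparseAverage T f N p
  have hhm : Measurable h := measurable_sparseAverage hT.measurable hfm N p
  have hhC : ∀ x, |h x| ≤ C := abs_sparseAverage_le hC hN0 p
  have hhi : Integrable h ν := integrable_of_abs_le hhm hhC
  have hh2 : Integrable (fun x => h x ^ 2) ν :=
    integrable_of_abs_le (hhm.pow_const 2) (C := C ^ 2) fun x => by
      rw [abs_pow]; exact pow_le_pow_left₀ (abs_nonneg _) (hhC x) 2
  have hsq : ∫ x, h x ^ 2 ∂ν ≤ a ^ 2 := by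
    refine (integral_sparseAverage_sq_le hT hfm hC (by positivity : 0 ≤ a ^ 2 / 2)
      (fun k hk => (hp k hk).le) hN0).trans ?_
    have : C ^ 2 / N ≤ a ^ 2 / 2 := by
      rw [div_lt_iff₀ (by positivity)] at hN
      rw [div_le_iff₀ hN']
      linarith
    linarith
  have habs := integral_abs_le_of_integral_sq_le hhi hh2 ha0 hsq
  have hweak := measureReal_exists_lt_birkhoffSum_le hT hhm.abs hhi.abs (fun x => abs_nonneg _) hε
  have hsub : {x | ¬ ∀ᶠ n : ℕ in atTop, |birkhoffSum T f n x| ≤ n * (2 * ε)} ⊆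
      {x | ∃ n : ℕ, n * ε < birkhoffSum T (fun x => |h x|) n x} := by
    intro x hx
    by_contra hcon
    refine hx ?_
    -- Of the `2ε`, one `ε` bounds the averages of `h`; the other absorbs the transfer error `2CNp`
    -- once `n ≥ 2CNp/ε`.
    simp only [mem_ofPred_eq, not_exists, not_lt] at hcon
    obtain ⟨n₀, hn₀⟩ := exists_nat_gt (2 * C * (N * p) / ε)
    filter_upwards [eventually_ge_atTop n₀] with n hn
    have h1 := abs_birkhoffSum_sparseAverage_sub_le (T := T) hC hN0 p n x
    have h2 : |birkhoffSum T h n x| ≤ n * ε :=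
      (Finset.abs_sum_le_sum_abs _ _).trans (hcon n)
    have h3 : 2 * C * (N * p) ≤ n * ε := by
      rw [div_lt_iff₀ hε] at hn₀
      have : (n₀ : ℝ) ≤ n := by exact_mod_cast hn
      nlinarith
    have h4 := abs_le.1 h1
    have h5 := abs_le.1 h2
    rw [abs_le]
    constructor <;> linarith
  refine (measureReal_mono hsub).trans (hweak.trans ?_)
  rw [div_le_iff₀ hε]
  linarith

/-- The pointwise ergodic theorem for a bounded centred observable with decaying correlations. -/
theorem ae_tendsto_birkhoffSum_div_zero [IsProbabilityMeasure ν]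
    (hT : MeasurePreserving T ν ν) (hfm : Measurable f) {C : ℝ} (hC : ∀ x, |f x| ≤ C)
    (hmix : Tendsto (fun k => ∫ x, f x * f (T^[k] x) ∂ν) atTop (𝓝 0)) :
    ∀ᵐ x ∂ν, Tendsto (fun n : ℕ => birkhoffSum T f n x / n) atTop (𝓝 0) := by
  have key : ∀ j : ℕ, ∀ᵐ x ∂ν, ∀ᶠ n : ℕ in atTop,
      |birkhoffSum T f n x| ≤ n * (2 * (1 / ((j : ℝ) + 1))) := by
    intro j
    have hj : (0 : ℝ) < 1 / ((j : ℝ) + 1) := by positivity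
    rw [ae_iff, ← measureReal_eq_zero_iff]
    exact le_antisymm (le_of_forall_pos_le_add fun δ hδ => by
      rw [zero_add]
      exact measureReal_not_eventually_birkhoffSum_le hT hfm hC hmix hj hδ) measureReal_nonneg
  filter_upwards [ae_all_iff.2 key] with x hx
  rw [Metric.tendsto_nhds]
  intro ε hε
  obtain ⟨j, hj⟩ := exists_nat_one_div_lt (half_pos hε)
  filter_upwards [hx j, eventually_gt_atTop 0] with n hn hn0
  have hn' : (0 : ℝ) < n := by exact_mod_cast hn0
  rw [Real.dist_eq, sub_zero, abs_div, abs_of_pos hn', div_lt_iff₀ hn']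
  nlinarith

/-- The pointwise ergodic theorem for a bounded observable whose correlations factor in the
limit. -/
theorem ae_tendsto_birkhoffSum_div [IsProbabilityMeasure ν]
    (hT : MeasurePreserving T ν ν) (hfm : Measurable f) {C : ℝ} (hC : ∀ x, |f x| ≤ C)
    (hmix : Tendsto (fun k => ∫ x, f x * f (T^[k] x) ∂ν) atTop (𝓝 ((∫ x, f x ∂ν) ^ 2))) :
    ∀ᵐ x ∂ν, Tendsto (fun n : ℕ => birkhoffSum T f n x / n) atTop (𝓝 (∫ x, f x ∂ν)) := by
  set m := ∫ x, f x ∂ν with hm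
  have hfi : Integrable f ν := integrable_of_abs_le hfm hC
  have hcorr : ∀ k, ∫ x, (f x - m) * (f (T^[k] x) - m) ∂ν =
      ∫ x, f x * f (T^[k] x) ∂ν - m ^ 2 := by
    intro k
    have hk := hT.iterate k
    have hfk : Integrable (fun x => f (T^[k] x)) ν := hk.integrable_comp_of_integrable hfi
    have hmul : Integrable (fun x => f x * f (T^[k] x)) ν :=
      integrable_of_abs_le (hfm.mul (hfm.comp hk.measurable)) (C := C * C) fun x => by
        rw [abs_mul]
        exact mul_le_mul (hC _) (hC _) (abs_nonneg _) ((abs_nonneg _).trans (hC x))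
    have hmk : ∫ x, f (T^[k] x) ∂ν = m := by
      rw [← integral_map (f := f) hk.aemeasurable hfm.aestronglyMeasurable, hk.map_eq]
    have : ∀ x, (f x - m) * (f (T^[k] x) - m) =
        f x * f (T^[k] x) - m * f x - m * f (T^[k] x) + m ^ 2 := fun x => by ring
    simp only [this]
    have i1 : Integrable (fun x => f x * f (T^[k] x) - m * f x) ν := hmul.sub (hfi.const_mul m)
    have i2 : Integrable (fun x => f x * f (T^[k] x) - m * f x - m * f (T^[k] x)) ν :=
      i1.sub (hfk.const_mul m)
    rw [integral_add i2 (integrable_const _), integral_sub i1 (hfk.const_mul m),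
      integral_sub hmul (hfi.const_mul m), integral_const_mul, integral_const_mul, hmk, ← hm]
    simp
    ring
  have h := ae_tendsto_birkhoffSum_div_zero (f := fun x => f x - m) hT (hfm.sub_const m)
    (C := C + |m|) (fun x => (abs_sub _ _).trans (by gcongr; exact hC x)) (by
      simp only [hcorr]
      rw [← sub_self (m ^ 2)]
      exact hmix.sub_const (m ^ 2))
  filter_upwards [h] with x hx
  have h2 := hx.add_const m
  rw [zero_add] at h2
  refine h2.congr' ?_
  filter_upwards [eventually_gt_atTop 0] with n hn
  have hn' : (n : ℝ) ≠ 0 := by exact_mod_cast hn.ne'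
  simp only [birkhoffSum, Finset.sum_sub_distrib, Finset.sum_const, Finset.card_range,
    nsmul_eq_mul]
  field_simp
  ring

end ErgodicAverage

/-! ### Uniform convergence from monotonicity. -/

/-- Antitone functions converging on the rationals to a continuous function converge uniformly
on compact sets. -/
theorem tendstoUniformlyOn_of_antitone_of_tendsto_rat {F : ℕ → ℝ → ℝ} {G : ℝ → ℝ}
    (hF : ∀ m, Antitone (F m)) (hG : Continuous G)
    (h : ∀ q : ℚ, Tendsto (fun m => F m q) atTop (𝓝 (G q))) {A : Set ℝ} (hA : IsCompact A) :
    TendstoUniformlyOn F G atTop A := by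
  refine (tendstoLocallyUniformlyOn_iff_tendstoUniformlyOn_of_compact hA).1 ?_
  refine TendstoLocallyUniformly.tendstoLocallyUniformlyOn ?_
  rw [Metric.tendstoLocallyUniformly_iff]
  intro ε hε x
  have hε4 : 0 < ε / 4 := by positivity
  obtain ⟨δ, hδ, hGδ⟩ := Metric.continuousAt_iff.1 hG.continuousAt (ε / 4) hε4
  -- On `(p, q)` monotonicity traps `F m y` between `F m q` and `F m p`, while `G` oscillates little
  -- on `[p, q]`.
  obtain ⟨p, hp1, hp2⟩ := exists_rat_btwn (sub_lt_self x hδ)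
  obtain ⟨q, hq1, hq2⟩ := exists_rat_btwn (lt_add_of_pos_right x hδ)
  refine ⟨Ioo (p : ℝ) q, Ioo_mem_nhds hp2 hq1, ?_⟩
  filter_upwards [Metric.tendsto_nhds.1 (h p) _ hε4, Metric.tendsto_nhds.1 (h q) _ hε4]
    with m hmp hmq y hy
  have hd : ∀ z : ℝ, p ≤ z → z ≤ q → |G z - G x| < ε / 4 := fun z h1 h2 =>
    hGδ (by rw [Real.dist_eq, abs_lt]; constructor <;> linarith)
  have hpq : (p : ℝ) ≤ q := (hp2.trans hq1).le
  have e1 := abs_lt.1 (hd p le_rfl hpq)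
  have e2 := abs_lt.1 (hd q hpq le_rfl)
  have e3 := abs_lt.1 (hd y hy.1.le hy.2.le)
  rw [Real.dist_eq, abs_lt] at hmp hmq
  have f1 := hF m hy.1.le
  have f2 := hF m hy.2.le
  rw [Real.dist_eq, abs_lt]
  constructor <;> linarith [hmp.1, hmp.2, hmq.1, hmq.2]

/-! ### Estimates for the cumulant and the immigration mechanism. -/

namespace CBI

section Mechanisms

variable {β b c : ℝ} {n : Measure ℝ}

theorem one_sub_exp_neg_nonneg {x y : ℝ} (hx : 0 ≤ x) (hy : 0 ≤ y) :
    0 ≤ 1 - Real.exp (-(x * y)) :=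
  sub_nonneg.2 (Real.exp_le_one_iff.2 (neg_nonpos.2 (mul_nonneg hx hy)))

theorem cumulant_nonneg (hb : 0 < b) (hc : 0 < c) {t l : ℝ} (ht : 0 ≤ t) (hl : 0 ≤ l) :
    0 ≤ cumulant b c t l := by
  have := one_sub_exp_neg_nonneg hb.le ht
  unfold cumulant
  positivity

theorem cumulant_le (hb : 0 < b) (hc : 0 < c) {t l : ℝ} (ht : 0 ≤ t) (hl : 0 ≤ l) :
    cumulant b c t l ≤ Real.exp (-(b * t)) * l := by
  have h := one_sub_exp_neg_nonneg hb.le ht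
  refine div_le_self (by positivity) ?_
  have : 0 ≤ c * l / b * (1 - Real.exp (-(b * t))) := by positivity
  linarith

theorem tendsto_cumulant (hb : 0 < b) (hc : 0 < c) {l : ℝ} (hl : 0 ≤ l) :
    Tendsto (fun t => cumulant b c t l) atTop (𝓝 0) := by
  have h : Tendsto (fun t : ℝ => Real.exp (-(b * t)) * l) atTop (𝓝 0) := by
    rw [← zero_mul l]
    exact (Real.tendsto_exp_neg_atTop_nhds_zero.comp
      (tendsto_id.const_mul_atTop hb)).mul_const l
  refine tendsto_of_tendsto_of_tendsto_of_le_of_le' tendsto_const_nhds h ?_ ?_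
  · filter_upwards [eventually_ge_atTop 0] with t ht using cumulant_nonneg hb hc ht hl
  · filter_upwards [eventually_ge_atTop 0] with t ht using cumulant_le hb hc ht hl

theorem antitoneOn_cumulant (hb : 0 < b) (hc : 0 < c) {l : ℝ} (hl : 0 ≤ l) :
    AntitoneOn (fun t => cumulant b c t l) (Ici 0) := by
  have hd : ∀ t ∈ Ici (0 : ℝ), HasDerivAt (fun s => cumulant b c s l)
      (-branching b c (cumulant b c t l)) t := fun t ht => hasDerivAt_cumulant hb hc ht hl
  refine antitoneOn_of_deriv_nonpos (convex_Ici 0)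
    (fun t ht => (hd t ht).continuousAt.continuousWithinAt)
    (fun t ht => (hd t (interior_subset ht)).differentiableAt.differentiableWithinAt)
    fun t ht => ?_
  have ht' := interior_subset ht
  rw [(hd t ht').deriv]
  have := cumulant_nonneg hb hc ht' hl
  unfold branching
  have h2 : 0 ≤ b * cumulant b c t l + c * cumulant b c t l ^ 2 := by positivity
  linarith

theorem integrableOn_min_one_of_density {k : ℝ → ℝ} (hk : Measurable k)
    (hk0 : ∀ z, 0 < z → 0 ≤ k z) (hk1 : IntegrableOn (fun z => min 1 z * k z) (Ioi 0))
    (hn : n = (volume.restrict (Ioi 0)).withDensity (fun z => ENNReal.ofReal (k z))) :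
    IntegrableOn (fun z => min 1 z) (Ioi 0) n := by
  rw [hn, IntegrableOn, restrict_withDensity measurableSet_Ioi,
    Measure.restrict_restrict measurableSet_Ioi, inter_self,
    integrable_withDensity_iff_integrable_smul' hk.ennreal_ofReal
      (Eventually.of_forall fun _ => ENNReal.ofReal_lt_top)]
  refine hk1.congr ?_
  filter_upwards [ae_restrict_mem measurableSet_Ioi] with z hz
  rw [ENNReal.toReal_ofReal (hk0 z hz), smul_eq_mul, mul_comm]

theorem integrableOn_one_sub_exp (hn : IntegrableOn (fun z => min 1 z) (Ioi 0) n) {z : ℝ}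
    (hz : 0 ≤ z) : IntegrableOn (fun u => 1 - Real.exp (-(z * u))) (Ioi 0) n := by
  -- The domination is `1 - e^{-zu} ≤ max(1,z) · min(1,u)`.
  refine (Integrable.const_mul hn (max 1 z)).mono' (by fun_prop) ?_
  filter_upwards [ae_restrict_mem measurableSet_Ioi] with u hu
  have hu0 : 0 < u := hu
  rw [Real.norm_of_nonneg (one_sub_exp_neg_nonneg hz hu0.le)]
  have h1 := Real.exp_pos (-(z * u))
  have h2 := Real.one_sub_le_exp_neg (z * u)
  rcases min_cases 1 u with ⟨h, -⟩ | ⟨h, -⟩ <;> rw [h]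
  · have := le_max_left 1 z
    linarith
  · have := mul_le_mul_of_nonneg_right (le_max_right 1 z) hu0.le
    linarith

theorem monotoneOn_immigration (hβ : 0 < β) (hn : IntegrableOn (fun z => min 1 z) (Ioi 0) n) :
    MonotoneOn (immigration β n) (Ici 0) := by
  intro x hx y hy hxy
  refine add_le_add (mul_le_mul_of_nonneg_left hxy hβ.le)
    (setIntegral_mono_on (integrableOn_one_sub_exp hn hx) (integrableOn_one_sub_exp hn hy)
      measurableSet_Ioi fun u hu => ?_)
  have : x * u ≤ y * u := mul_le_mul_of_nonneg_right hxy (le_of_lt hu)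
  exact sub_le_sub_left (Real.exp_le_exp.2 (neg_le_neg this)) 1

theorem immigration_nonneg (hβ : 0 < β) (hn : IntegrableOn (fun z => min 1 z) (Ioi 0) n) {z : ℝ}
    (hz : 0 ≤ z) : 0 ≤ immigration β n z := by
  have h := monotoneOn_immigration hβ hn self_mem_Ici hz hz
  simpa [immigration] using h

/-- A monotone function of an antitone one is antitone, so no continuity of `ψ` is needed. -/
theorem intervalIntegrable_immigration_cumulant (hβ : 0 < β) (hb : 0 < b) (hc : 0 < c)
    (hn : IntegrableOn (fun z => min 1 z) (Ioi 0) n) {t l : ℝ} (ht : 0 ≤ t) (hl : 0 ≤ l) :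
    IntervalIntegrable (fun s => immigration β n (cumulant b c s l)) volume 0 t := by
  refine AntitoneOn.intervalIntegrable fun x hx y hy hxy => ?_
  rw [uIcc_of_le ht] at hx hy
  exact monotoneOn_immigration hβ hn (cumulant_nonneg hb hc hy.1 hl)
    (cumulant_nonneg hb hc hx.1 hl) (antitoneOn_cumulant hb hc hl hx.1 hy.1 hxy)

end Mechanisms

/-! ### Laplace transforms of probability measures on the half-line. -/

section LaplaceTransform

variable {η : Measure ℝ≥0} [IsProbabilityMeasure η]

theorem measurable_exp_neg_mul (l : ℝ) : Measurable fun x : ℝ≥0 => Real.exp (-(l * x)) := by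
  fun_prop

theorem exp_neg_mul_le_one {l : ℝ} (hl : 0 ≤ l) (x : ℝ≥0) : Real.exp (-(l * x)) ≤ 1 :=
  Real.exp_le_one_iff.2 (neg_nonpos.2 (mul_nonneg hl x.2))

theorem integrable_exp_neg_mul {l : ℝ} (hl : 0 ≤ l) :
    Integrable (fun x : ℝ≥0 => Real.exp (-(l * x))) η :=
  Integrable.of_bound (measurable_exp_neg_mul l).aestronglyMeasurable 1
    (Eventually.of_forall fun x => by
      rw [Real.norm_of_nonneg (Real.exp_pos _).le]
      exact exp_neg_mul_le_one hl x)

theorem laplaceTransform_pos {l : ℝ} (hl : 0 ≤ l) : 0 < laplaceTransform η l :=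
  integral_exp_pos (integrable_exp_neg_mul hl)

theorem laplaceTransform_zero : laplaceTransform η 0 = 1 := by
  simp [laplaceTransform]

/-- Truncating at `0` keeps the integrand bounded by `1`, giving a continuous function on all of `ℝ`
that agrees with the transform on `[0,∞)`. -/
theorem continuous_laplaceTransform_max_zero :
    Continuous fun l : ℝ => laplaceTransform η (max l 0) := by
  refine continuous_of_dominated (bound := fun _ => 1)
    (fun l => (measurable_exp_neg_mul _).aestronglyMeasurable)
    (fun l => Eventually.of_forall fun x => ?_) (integrable_const _)
    (Eventually.of_forall fun x => by fun_prop)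
  rw [Real.norm_of_nonneg (Real.exp_pos _).le]
  exact exp_neg_mul_le_one (le_max_right _ _) x

theorem tendsto_laplaceTransform {ι : Type*} {F : Filter ι} {u : ι → ℝ} {a : ℝ}
    (hu : Tendsto u F (𝓝 a)) (ha : 0 ≤ a) (hu0 : ∀ᶠ i in F, 0 ≤ u i) :
    Tendsto (fun i => laplaceTransform η (u i)) F (𝓝 (laplaceTransform η a)) := by
  have h := (continuous_laplaceTransform_max_zero (η := η)).continuousAt.tendsto.comp hu
  rw [max_eq_left ha] at h
  refine h.congr' ?_
  filter_upwards [hu0] with i hi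
  simp only [Function.comp, max_eq_left hi]

end LaplaceTransform

/-! ### Stationary CBI-processes: invariant law, mixing, law of large numbers. -/

section Stationary

variable {Ω : Type*}

theorem iterate_shift (h : ℝ≥0) (k : ℕ) (x : ℝ≥0 → ℝ≥0) (t : ℝ≥0) :
    ((fun (x : ℝ≥0 → ℝ≥0) t => x (t + h))^[k] x) t = x (t + k * h) := by
  induction k generalizing t with
  | zero => simp
  | succ k ih =>
    rw [Function.iterate_succ_apply', ih]
    push_cast
    congr 1
    ring

theorem antitone_empiricalLaplace_max_zero (X : ℝ≥0 → Ω → ℝ≥0) (m : ℕ) (ω : Ω) :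
    Antitone fun l => empiricalLaplace X m (max l 0) ω := by
  intro x y hxy
  simp only [empiricalLaplace]
  refine mul_le_mul_of_nonneg_left (Finset.sum_le_sum fun k _ => Real.exp_le_exp.2
    (neg_le_neg ?_)) (by positivity)
  gcongr

variable [MeasurableSpace Ω] {μ : Measure Ω} {X : ℝ≥0 → Ω → ℝ≥0}

theorem map_eq_of_isStationary (hXm : ∀ t, Measurable (X t)) (hstat : IsStationary X μ)
    (t : ℝ≥0) : μ.map (X t) = μ.map (X 0) := by
  have h := congrArg (Measure.map fun x : ℝ≥0 → ℝ≥0 => x 0) (hstat t)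
  rw [Measure.map_map (measurable_pi_apply _) (measurable_pi_lambda _ fun s => hXm _),
    Measure.map_map (measurable_pi_apply _) (measurable_pi_lambda _ fun s => hXm _)] at h
  simpa [Function.comp_def] using h

/-- `Ω` carries no dynamics, so the ergodic theorem is run on path space with the law of the
process. -/
theorem measurePreserving_shift (hXm : ∀ t, Measurable (X t)) (hstat : IsStationary X μ)
    (h : ℝ≥0) :
    MeasurePreserving (fun (x : ℝ≥0 → ℝ≥0) t => x (t + h))
      (μ.map fun ω t => X t ω) (μ.map fun ω t => X t ω) := by
  have hm : Measurable fun (x : ℝ≥0 → ℝ≥0) t => x (t + h) :=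
    measurable_pi_lambda _ fun t => measurable_pi_apply _
  refine ⟨hm, ?_⟩
  rw [Measure.map_map hm (measurable_pi_lambda _ fun s => hXm _)]
  exact hstat h

variable [IsProbabilityMeasure μ] {β b c : ℝ} {n : Measure ℝ} {P : ℝ≥0 → Kernel ℝ≥0 ℝ≥0}

/-- The joint law of a Markov process at two times. -/
theorem map_prodMk_eq_compProd (hXm : ∀ t, Measurable (X t)) [∀ t, IsMarkovKernel (P t)]
    (hX : ∀ (s t : ℝ≥0) (A : Set ℝ≥0), MeasurableSet A →
      μ⟦X (s + t) ⁻¹' A | history X s⟧ =ᵐ[μ] fun ω => (P t (X s ω)).real A) (s t : ℝ≥0) :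
    μ.map (fun ω => (X s ω, X (s + t) ω)) = (μ.map (X s)) ⊗ₘ (P t) := by
  have hpair : Measurable fun ω => (X s ω, X (s + t) ω) := (hXm s).prodMk (hXm (s + t))
  have := Measure.isProbabilityMeasure_map (μ := μ) hpair.aemeasurable
  have := Measure.isProbabilityMeasure_map (μ := μ) (hXm s).aemeasurable
  have hle : history X s ≤ ‹MeasurableSpace Ω› := iSup_le fun r => (hXm r).comap_le
  refine Measure.ext_prod fun {A B} hA hB => ?_
  have hAm : MeasurableSet[history X s] (X s ⁻¹' A) :=
    le_iSup (fun r : Iic s => MeasurableSpace.comap (X r) inferInstance) ⟨s, self_mem_Iic⟩ _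
      ⟨A, hA, rfl⟩
  have hBm : MeasurableSet (X (s + t) ⁻¹' B) := hXm _ hB
  have h1 := setIntegral_condExp (μ := μ) hle
    ((integrable_const (1 : ℝ)).indicator hBm) hAm
  rw [setIntegral_congr_ae (hle _ hAm) ((hX s t B hB).mono fun ω h _ => h),
    integral_indicator hBm, setIntegral_const, smul_eq_mul, mul_one,
    measureReal_restrict_apply hBm] at h1
  rw [Measure.map_apply hpair (hA.prod hB), Measure.compProd_apply_prod hA hB,
    setLIntegral_map hA ((P t).measurable_coe hB) (hXm s)]
  have hm : Measurable fun ω => P t (X s ω) B := ((P t).measurable_coe hB).comp (hXm s)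
  simp only [measureReal_def] at h1
  rw [integral_toReal hm.aemeasurable (Eventually.of_forall fun ω => measure_lt_top _ _),
    ENNReal.toReal_eq_toReal_iff' ?_ (measure_ne_top _ _)] at h1
  · rw [h1]
    congr 1
    ext ω
    simp [and_comm]
  · refine ne_top_of_le_ne_top (b := ∫⁻ ω in X s ⁻¹' A, 1 ∂μ) (by simp) ?_
    exact lintegral_mono fun ω => prob_le_one

/-- Integrating out `X_{s+t}` given `X_s = x` leaves an exponential that is affine in `x`, which
merges with `e^{-a x}`. -/
theorem integral_exp_mul_exp (hXm : ∀ t, Measurable (X t)) (hP : IsTransitionSemigroup β b c n P)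
    (hX : ∀ (s t : ℝ≥0) (A : Set ℝ≥0), MeasurableSet A →
      μ⟦X (s + t) ⁻¹' A | history X s⟧ =ᵐ[μ] fun ω => (P t (X s ω)).real A) (s t : ℝ≥0)
    {a l : ℝ} (ha : 0 ≤ a) (hl : 0 ≤ l) :
    ∫ ω, Real.exp (-(a * X s ω)) * Real.exp (-(l * X (s + t) ω)) ∂μ =
      laplaceTransform (μ.map (X s)) (a + cumulant b c t l) *
        Real.exp (-∫ r in (0 : ℝ)..t, immigration β n (cumulant b c r l)) := by
  have := hP.markov
  have hpair : Measurable fun ω => (X s ω, X (s + t) ω) := (hXm s).prodMk (hXm (s + t))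
  have := Measure.isProbabilityMeasure_map (μ := μ) (hXm s).aemeasurable
  set g : ℝ≥0 × ℝ≥0 → ℝ := fun p => Real.exp (-(a * p.1)) * Real.exp (-(l * p.2)) with hg
  have hgm : Measurable g := by fun_prop
  have hgi : Integrable g ((μ.map (X s)) ⊗ₘ (P t)) :=
    Integrable.of_bound hgm.aestronglyMeasurable 1 (Eventually.of_forall fun p => by
      rw [Real.norm_of_nonneg (by positivity)]
      exact mul_le_one₀ (exp_neg_mul_le_one ha _) (Real.exp_pos _).le (exp_neg_mul_le_one hl _))
  have h1 : ∫ ω, Real.exp (-(a * X s ω)) * Real.exp (-(l * X (s + t) ω)) ∂μ =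
      ∫ p, g p ∂((μ.map (X s)) ⊗ₘ (P t)) := by
    rw [← map_prodMk_eq_compProd hXm hX, integral_map hpair.aemeasurable
      hgm.aestronglyMeasurable]
  rw [h1, Measure.integral_compProd hgi, laplaceTransform, ← integral_mul_const]
  refine integral_congr_ae (Eventually.of_forall fun x => ?_)
  simp only [hg]
  rw [integral_const_mul, hP.laplace t x l hl, ← Real.exp_add, ← Real.exp_add]
  congr 1
  ring

theorem exp_neg_integral_eq_div (hXm : ∀ t, Measurable (X t))
    (hP : IsTransitionSemigroup β b c n P)
    (hX : ∀ (s t : ℝ≥0) (A : Set ℝ≥0), MeasurableSet A →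
      μ⟦X (s + t) ⁻¹' A | history X s⟧ =ᵐ[μ] fun ω => (P t (X s ω)).real A)
    (hstat : IsStationary X μ) (hb : 0 < b) (hc : 0 < c) (t : ℝ≥0) {l : ℝ} (hl : 0 ≤ l) :
    Real.exp (-∫ r in (0 : ℝ)..t, immigration β n (cumulant b c r l)) =
      laplaceTransform (μ.map (X 0)) l / laplaceTransform (μ.map (X 0)) (cumulant b c t l) := by
  have := Measure.isProbabilityMeasure_map (μ := μ) (hXm 0).aemeasurable
  have h := integral_exp_mul_exp hXm hP hX 0 t le_rfl hl
  have h2 : laplaceTransform (μ.map (X 0)) l = ∫ ω, Real.exp (-(l * X t ω)) ∂μ := by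
    rw [← map_eq_of_isStationary hXm hstat t, laplaceTransform,
      integral_map (hXm t).aemeasurable (measurable_exp_neg_mul l).aestronglyMeasurable]
  simp only [zero_mul, neg_zero, Real.exp_zero, one_mul, zero_add] at h
  rw [eq_div_iff (laplaceTransform_pos (cumulant_nonneg hb hc t.coe_nonneg hl)).ne', h2, h, mul_comm]

/-- In the quotient formula the denominator tends to `L(0) = 1`, because the cumulant vanishes at
infinity. -/
theorem tendsto_exp_neg_integral (hXm : ∀ t, Measurable (X t))
    (hP : IsTransitionSemigroup β b c n P)
    (hX : ∀ (s t : ℝ≥0) (A : Set ℝ≥0), MeasurableSet A →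
      μ⟦X (s + t) ⁻¹' A | history X s⟧ =ᵐ[μ] fun ω => (P t (X s ω)).real A)
    (hstat : IsStationary X μ) (hb : 0 < b) (hc : 0 < c) {l : ℝ} (hl : 0 ≤ l) :
    Tendsto (fun k : ℕ => Real.exp (-∫ r in (0 : ℝ)..k, immigration β n (cumulant b c r l)))
      atTop (𝓝 (laplaceTransform (μ.map (X 0)) l)) := by
  have := Measure.isProbabilityMeasure_map (μ := μ) (hXm 0).aemeasurable
  have hv := tendsto_laplaceTransform (η := μ.map (X 0))
    ((tendsto_cumulant hb hc hl).comp tendsto_natCast_atTop_atTop) le_rfl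
    (Eventually.of_forall fun k : ℕ => cumulant_nonneg hb hc k.cast_nonneg hl)
  rw [laplaceTransform_zero] at hv
  have h := (tendsto_const_nhds (x := laplaceTransform (μ.map (X 0)) l)).div hv one_ne_zero
  rw [div_one] at h
  refine h.congr fun k => ?_
  exact_mod_cast (exp_neg_integral_eq_div hXm hP hX hstat hb hc k hl).symm

theorem integrableOn_and_laplaceTransform_eq (hXm : ∀ t, Measurable (X t))
    (hP : IsTransitionSemigroup β b c n P)
    (hX : ∀ (s t : ℝ≥0) (A : Set ℝ≥0), MeasurableSet A →
      μ⟦X (s + t) ⁻¹' A | history X s⟧ =ᵐ[μ] fun ω => (P t (X s ω)).real A)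
    (hstat : IsStationary X μ) (hβ : 0 < β) (hb : 0 < b) (hc : 0 < c)
    (hn : IntegrableOn (fun z => min 1 z) (Ioi 0) n) {l : ℝ} (hl : 0 ≤ l) :
    IntegrableOn (fun s => immigration β n (cumulant b c s l)) (Ioi 0) ∧
      laplaceTransform (μ.map (X 0)) l =
        Real.exp (-∫ s in Ioi (0 : ℝ), immigration β n (cumulant b c s l)) := by
  have := Measure.isProbabilityMeasure_map (μ := μ) (hXm 0).aemeasurable
  have hlim := tendsto_exp_neg_integral hXm hP hX hstat hb hc hl
  have hlog := (hlim.log (laplaceTransform_pos hl).ne').neg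
  simp only [Real.log_exp, neg_neg] at hlog
  have hint : IntegrableOn (fun s => immigration β n (cumulant b c s l)) (Ioi 0) := by
    -- The integrand is nonnegative, so convergence of its integrals over `[0,k]` is convergence of
    -- the integrals of its norm.
    refine integrableOn_Ioi_of_intervalIntegral_norm_tendsto _ 0 (fun k : ℕ => ?_)
      tendsto_natCast_atTop_atTop (hlog.congr fun k : ℕ => ?_)
    · exact (intervalIntegrable_iff_integrableOn_Ioc_of_le k.cast_nonneg).1
        (intervalIntegrable_immigration_cumulant hβ hb hc hn k.cast_nonneg hl)
    · refine intervalIntegral.integral_congr fun s hs => ?_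
      rw [uIcc_of_le k.cast_nonneg] at hs
      exact (Real.norm_of_nonneg
        (immigration_nonneg hβ hn (cumulant_nonneg hb hc hs.1 hl))).symm
  refine ⟨hint, tendsto_nhds_unique hlim ?_⟩
  exact (Real.continuous_exp.tendsto _).comp
    (intervalIntegral_tendsto_integral_Ioi 0 hint tendsto_natCast_atTop_atTop).neg

/-- The first factor tends to `L(l + 0)` and the second to `L(l)`. -/
theorem tendsto_integral_exp_mul_exp (hXm : ∀ t, Measurable (X t))
    (hP : IsTransitionSemigroup β b c n P)
    (hX : ∀ (s t : ℝ≥0) (A : Set ℝ≥0), MeasurableSet A →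
      μ⟦X (s + t) ⁻¹' A | history X s⟧ =ᵐ[μ] fun ω => (P t (X s ω)).real A)
    (hstat : IsStationary X μ) (hb : 0 < b) (hc : 0 < c) (s : ℝ≥0) {l : ℝ} (hl : 0 ≤ l) :
    Tendsto (fun k : ℕ => ∫ ω, Real.exp (-(l * X s ω)) * Real.exp (-(l * X (s + k) ω)) ∂μ) atTop
      (𝓝 (laplaceTransform (μ.map (X 0)) l ^ 2)) := by
  have := Measure.isProbabilityMeasure_map (μ := μ) (hXm 0).aemeasurable
  have hv : Tendsto (fun k : ℕ => l + cumulant b c k l) atTop (𝓝 l) := by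
    simpa using ((tendsto_cumulant hb hc hl).comp tendsto_natCast_atTop_atTop).const_add l
  have h := (tendsto_laplaceTransform (η := μ.map (X 0)) hv hl
    (Eventually.of_forall fun k : ℕ => add_nonneg hl
      (cumulant_nonneg hb hc k.cast_nonneg hl))).mul
        (tendsto_exp_neg_integral hXm hP hX hstat hb hc hl)
  rw [← pow_two] at h
  refine h.congr fun k => ?_
  rw [integral_exp_mul_exp hXm hP hX s k hl hl, map_eq_of_isStationary hXm hstat s]
  simp

theorem ae_tendsto_empiricalLaplace (hXm : ∀ t, Measurable (X t))
    (hP : IsTransitionSemigroup β b c n P)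
    (hX : ∀ (s t : ℝ≥0) (A : Set ℝ≥0), MeasurableSet A →
      μ⟦X (s + t) ⁻¹' A | history X s⟧ =ᵐ[μ] fun ω => (P t (X s ω)).real A)
    (hstat : IsStationary X μ) (hb : 0 < b) (hc : 0 < c) {l : ℝ} (hl : 0 ≤ l) :
    ∀ᵐ ω ∂μ, Tendsto (fun m => empiricalLaplace X m l ω) atTop
      (𝓝 (laplaceTransform (μ.map (X 0)) l)) := by
  have hpath : Measurable fun ω t => X t ω := measurable_pi_lambda _ fun t => hXm t
  have := Measure.isProbabilityMeasure_map (μ := μ) hpath.aemeasurable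
  -- Evaluating at time `1` rather than `0` makes the first `m` Birkhoff terms run over times `1, …,
  -- m`.
  set f : (ℝ≥0 → ℝ≥0) → ℝ := fun x => Real.exp (-(l * x 1)) with hf
  have hfm : Measurable f := (measurable_exp_neg_mul l).comp (measurable_pi_apply 1)
  have hint : ∫ x, f x ∂(μ.map fun ω t => X t ω) = laplaceTransform (μ.map (X 0)) l := by
    rw [integral_map hpath.aemeasurable hfm.aestronglyMeasurable,
      ← map_eq_of_isStationary hXm hstat 1, laplaceTransform,
      integral_map (hXm 1).aemeasurable (measurable_exp_neg_mul l).aestronglyMeasurable]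
  have hT := measurePreserving_shift hXm hstat 1
  have h := ErgodicAverage.ae_tendsto_birkhoffSum_div hT hfm (C := 1)
    (fun x => by
      rw [abs_of_pos (Real.exp_pos _)]
      exact exp_neg_mul_le_one hl _) (by
      rw [hint]
      refine (tendsto_integral_exp_mul_exp hXm hP hX hstat hb hc 1 hl).congr fun k => ?_
      have hmul : Measurable fun x => f x * f ((fun (x : ℝ≥0 → ℝ≥0) t => x (t + 1))^[k] x) :=
        hfm.mul (hfm.comp (hT.measurable.iterate k))
      rw [integral_map hpath.aemeasurable hmul.aestronglyMeasurable]
      simp only [hf, iterate_shift, mul_one])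
  rw [hint] at h
  filter_upwards [ae_of_ae_map hpath.aemeasurable h] with ω hω
  refine hω.congr fun m => ?_
  simp only [empiricalLaplace, birkhoffSum, hf, iterate_shift, mul_one]
  rw [Finset.range_eq_Ico, div_eq_inv_mul, one_div]
  congr 1
  have := Finset.sum_Ico_add' (fun k : ℕ => Real.exp (-(l * X (k : ℝ≥0) ω))) 0 m 1
  rw [zero_add] at this
  refine Eq.trans ?_ this
  simp only [Nat.cast_add, Nat.cast_one, add_comm]

end Stationary

end CBI

end

theorem corollary4p1 {Ω : Type*} [MeasurableSpace Ω] (μ : Measure Ω) [IsProbabilityMeasure μ]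
    (β b c : ℝ) (hβ : 0 < β) (hb : 0 < b) (hc : 0 < c)
    -- the density `k` of the jump measure `n(dz) = k(z) dz` on `(0,∞)`
    (k : ℝ → ℝ) (hk : Measurable k) (hk0 : ∀ z, 0 < z → 0 ≤ k z)
    (hk1 : IntegrableOn (fun z => min 1 z * k z) (Ioi 0))
    (n : Measure ℝ)
    (hn : n = (volume.restrict (Ioi 0)).withDensity (fun z => ENNReal.ofReal (k z)))
    (X : ℝ≥0 → Ω → ℝ≥0)
    (hX : CBI.IsCBIProcess β b c n X μ) (hstat : CBI.IsStationary X μ)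
    -- the stationary distribution
    (η : Measure ℝ≥0) (hη : η = μ.map (X 0)) :
    (∀ l : ℝ, 0 ≤ l →
      IntegrableOn (fun s => CBI.immigration β n (CBI.cumulant b c s l)) (Ioi 0) ∧
      CBI.laplaceTransform η l =
        Real.exp (-∫ s in Ioi (0 : ℝ), CBI.immigration β n (CBI.cumulant b c s l))) ∧
    ∀ᵐ ω ∂μ, ∀ A : Set ℝ, IsCompact A → A ⊆ Ici 0 →
      Tendsto (fun m : ℕ =>
          sSup ((fun l => |CBI.empiricalLaplace X m l ω - CBI.laplaceTransform η l|) '' A))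
        atTop (𝓝 0) := by
  obtain ⟨hXm, P, hP, hM⟩ := hX
  subst hη
  have := Measure.isProbabilityMeasure_map (μ := μ) (hXm 0).aemeasurable
  refine ⟨fun l hl => CBI.integrableOn_and_laplaceTransform_eq hXm hP hM hstat hβ hb hc
    (CBI.integrableOn_min_one_of_density hk hk0 hk1 hn) hl, ?_⟩
  -- Only countably many null sets are discarded, before `A` is chosen.
  have hae : ∀ᵐ ω ∂μ, ∀ q : ℚ, Tendsto (fun m => CBI.empiricalLaplace X m (max (q : ℝ) 0) ω) atTop
      (𝓝 (CBI.laplaceTransform (μ.map (X 0)) (max (q : ℝ) 0))) :=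
    ae_all_iff.2 fun q =>
      CBI.ae_tendsto_empiricalLaplace hXm hP hM hstat hb hc (le_max_right _ _)
  filter_upwards [hae] with ω hω A hA hA0
  have hu := tendstoUniformlyOn_of_antitone_of_tendsto_rat
    (fun m => CBI.antitone_empiricalLaplace_max_zero X m ω)
    (CBI.continuous_laplaceTransform_max_zero (η := μ.map (X 0))) hω hA
  rw [Metric.tendsto_nhds]
  intro ε hε
  filter_upwards [Metric.tendstoUniformlyOn_iff.1 hu (ε / 2) (half_pos hε)] with m hm
  have h0 : 0 ≤ sSup ((fun l => |CBI.empiricalLaplace X m l ω -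
      CBI.laplaceTransform (μ.map (X 0)) l|) '' A) :=
    Real.sSup_nonneg (by rintro _ ⟨l, -, rfl⟩; exact abs_nonneg _)
  -- Passing to the supremum loses strictness, hence `ε / 2`; `Real.sSup_le` also covers empty `A`.
  have h1 : sSup ((fun l => |CBI.empiricalLaplace X m l ω -
      CBI.laplaceTransform (μ.map (X 0)) l|) '' A) ≤ ε / 2 := by
    refine Real.sSup_le ?_ (half_pos hε).le
    rintro _ ⟨l, hl, rfl⟩
    have := hm l hl
    rw [dist_comm, Real.dist_eq, max_eq_left (hA0 hl)] at this
    exact this.le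
  rw [Real.dist_eq, sub_zero, abs_of_nonneg h0]
  linarith
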